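/- Let $n,s,t\in\mathbb N$, $N=2^n$, and let $\varepsilon\in\mathbb R$. Let $\alpha^{(1)},\dots,\alpha^{(s)}\in\mathbb C^{\{0,1\}^n}$ be orthonormal vectors (pure states) that are $\varepsilon$-flat, i.e. $|\alpha^{(j)}_x|^2\le\varepsilon$ for all $j\in[s]$ and $x\in\{0,1\}^n$. For $g:\{0,1\}^n\to\{\pm1\}$ and a permutation $\pi$ of $\{0,1\}^n$ let $U_g|x\rangle=g(x)|x\rangle$ and $U_\pi|x\rangle=|\pi(x)\rangle$, and put $$\rho=\mathbb E_{g,\pi}\Big[(U_\pi U_g)^{\otimes st}\Big(\bigotimes_{j\in[s]}\big(|\alpha^{(j)}\rangle\langle\alpha^{(j)}|\big)^{\otimes t}\Big)(U_g^\dagger U_\pi^\dagger)^{\otimes st}\Big],$$ where $g$ is a uniformly random function and $\pi$ an independent, uniformly random permutation. Let $$\rho_{\mathrm{uni}}=\frac1{N(N-1)\cdots(N-st+1)}\sum_{z}\sum_{\sigma\in S_t^s}|z\rangle\langle\sigma(z)|,$$ where $z$ runs over the tuples $(z_{j,i})_{j\in[s],i\in[t]}$ of pairwise distinct elements of $\{0,1\}^n$,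 and $\sigma=(\sigma_1,\dots,\sigma_s)\in S_t^s$ permutes the entries within each block, $\sigma(z)_{j,i}=z_{j,\sigma_j(i)}$ (if $st>N$ the sum is empty and $\rho_{\mathrm{uni}}$ is read as $0$). Then $$\|\rho-\rho_{\mathrm{uni}}\|_1\le C\big((st)^2\varepsilon+N s^6t^4\varepsilon^2\big)$$ for a universal constant $C>0$ (independent of $n,s,t,\varepsilon$ and the vectors), where $\|A\|_1=\mathrm{Tr}\sqrt{AA^\dagger}$ is the trace norm. -/

import Mathlib

open scoped BigOperators Matrix

noncomputable section

/-- Computational basis labels of `n` qubits, that is `{0,1}^n`. -/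
abbrev BitString (n : ℕ) : Type := Fin n → Bool

/-- Positions in an `st`-tuple, organised in `s` blocks of length `t`. -/
abbrev BlockIndex (s t : ℕ) : Type := Fin s × Fin t

/-- `st`-tuples of `n`-bit strings: basis labels of `st` registers of `n` qubits each. -/
abbrev Tuple (n s t : ℕ) : Type := BlockIndex s t → BitString n

/-- Operators on `st` registers of `n` qubits each, in the computational basis. -/
abbrev RegisterOp (n s t : ℕ) : Type := Matrix (Tuple n s t) (Tuple n s t) ℂ

/-- The trace norm `‖A‖₁ = Tr √(A A†)`; the square root is the one of the continuous functional
calculus of Hermitian matrices (and the trace is a real number). -/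
def traceNorm {m : Type*} [Fintype m] [DecidableEq m] (A : Matrix m m ℂ) : ℝ :=
  (Matrix.trace (cfc Real.sqrt (A * Aᴴ))).re

/-- A vector is `ε`-flat if every computational basis coefficient `α_x` has `|α_x|² ≤ ε`. -/
def IsFlat {n : ℕ} (ε : ℝ) (α : EuclideanSpace ℂ (BitString n)) : Prop :=
  ∀ x : BitString n, ‖α x‖ ^ 2 ≤ ε

/-- The rank-one operator `|α⟩⟨α|`. -/
def ketBra {n : ℕ} (α : EuclideanSpace ℂ (BitString n)) :
    Matrix (BitString n) (BitString n) ℂ :=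
  Matrix.of fun x y => α x * star (α y)

/-- The tensor product `⨂ᵢ Bᵢ` of operators on `n` qubits over all `st` registers. -/
def tensorOp {n s t : ℕ} (B : BlockIndex s t → Matrix (BitString n) (BitString n) ℂ) :
    RegisterOp n s t :=
  Matrix.of fun z z' => ∏ v, B v (z v) (z' v)

/-- The phase unitary `U_g |x⟩ = g(x) |x⟩` of a function `g : {0,1}^n → {±1}`. -/
def phaseOp {n : ℕ} (g : BitString n → ℤˣ) : Matrix (BitString n) (BitString n) ℂ :=
  Matrix.diagonal fun x => ((g x : ℤ) : ℂ)

/-- The permutation unitary `U_π |x⟩ = |π(x)⟩`. -/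
def permOp {n : ℕ} (π : Equiv.Perm (BitString n)) : Matrix (BitString n) (BitString n) ℂ :=
  Matrix.of fun y x => if y = π x then 1 else 0

/-- The input state `⨂_{j ∈ [s]} |α_j⟩⟨α_j|^{⊗ t}`. -/
def inputState {n s : ℕ} (t : ℕ) (α : Fin s → EuclideanSpace ℂ (BitString n)) :
    RegisterOp n s t :=
  tensorOp fun v => ketBra (α v.1)

/-- The averaged output state
`ρ = 𝔼_{g,π} (U_π U_g)^{⊗ st} (⨂_j |α_j⟩⟨α_j|^{⊗ t}) (U_g† U_π†)^{⊗ st}`, where `g` and `π` are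
independent and uniform. -/
def outputState {n s : ℕ} (t : ℕ) (α : Fin s → EuclideanSpace ℂ (BitString n)) :
    RegisterOp n s t :=
  𝔼 g : BitString n → ℤˣ, 𝔼 π : Equiv.Perm (BitString n),
    tensorOp (fun _ : BlockIndex s t => permOp π * phaseOp g) * inputState t α *
      tensorOp (fun _ : BlockIndex s t => (phaseOp g)ᴴ * (permOp π)ᴴ)

/-- The index permutation `(j, i) ↦ (j, σ_j(i))` of an element `σ` of `S_t^s`. -/
def blockPerm {s t : ℕ} (σ : Fin s → Equiv.Perm (Fin t)) : Equiv.Perm (BlockIndex s t) :=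
  Equiv.prodCongrRight σ

/-- `ρ_uni = (1 / (N (N-1) ⋯ (N-st+1))) ∑_z ∑_{σ ∈ S_t^s} |z⟩⟨σ(z)|` with `N = 2^n`, where `z` runs
over the `st`-tuples with pairwise distinct entries and `σ(z)_v = z_{σ(v)}`. -/
def uniState (n s t : ℕ) : RegisterOp n s t :=
  (((2 ^ n).descFactorial (s * t) : ℕ) : ℂ)⁻¹ •
    ∑ z : BlockIndex s t ↪ BitString n, ∑ σ : Fin s → Equiv.Perm (Fin t),
      Matrix.single (z : Tuple n s t) (fun v => z (blockPerm σ v)) 1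

end

/-
Averaging over the phases `g` annihilates every entry `(z, z')` of `ρ` with `z` or `z'` injective,
unless `z'` is a rearrangement `z ∘ τ` of `z`; averaging over `π` makes the remaining entries depend
on `τ` only. Sorting the rearrangements by the colouring `f = c ∘ τ⁻¹` they induce, where `c v` is
the index of the state in register `v`, gives

  `ρ = (collision part) + ∑ f, overlap α c f • recolorOp X c f`,  with `recolorOp X c c = ρ_uni`.

With `n = st` registers and `k = s` colours, a collision has probability at most `n² ε`, which
bounds the collision part and `1 - overlap α c c`. For `f ≠ c` the overlap is a sum over injective
tuples with one orthogonality relation for each position at which `f` and `c` differ, so if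
`n ε ≤ 1` it is at most `√(n ε)` to the power of their Hamming distance. That distance is at least
`2` when `f` is a rearrangement of `c`, and all other `recolorOp X c f` vanish. Summing over `f`
gives `O(k² n³ ε)` if `k² n³ ε ≤ 1`, while otherwise the trivial bound `2` on the trace distance
suffices; finally `k² n³ ε ≤ N k² n⁴ ε²` because flatness forces `N ε ≥ 1`.
-/
section TraceNorm

open scoped Matrix.Norms.L2Operator MatrixOrder ComplexOrder

theorem mul_eq_of_mul_mul_conjTranspose_eq {m n : Type*} [Fintype m] [Fintype n]
    {E : Matrix m m ℂ} {A : Matrix m n ℂ} (h : E * (A * Aᴴ) = A * Aᴴ) : E * A = A := by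
  rw [← sub_eq_zero, ← Matrix.self_mul_conjTranspose_eq_zero, Matrix.conjTranspose_sub,
    Matrix.conjTranspose_mul, Matrix.mul_sub, ← Matrix.mul_assoc, Matrix.sub_mul,
    Matrix.mul_assoc, h, sub_self, Matrix.zero_mul, sub_zero]

variable {m : Type*} [Fintype m] [DecidableEq m]

theorem exists_polar_decomposition (A : Matrix m m ℂ) :
    ∃ V : Matrix m m ℂ, ‖V‖ ≤ 1 ∧
      A = cfc Real.sqrt (A * Aᴴ) * V ∧ A * Vᴴ = cfc Real.sqrt (A * Aᴴ) := by
  set P : Matrix m m ℂ := A * Aᴴ with hP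
  have hPsd : P.PosSemidef := Matrix.posSemidef_self_mul_conjTranspose A
  have hPsa : IsSelfAdjoint P := hPsd.isHermitian
  have hspec : ∀ x ∈ spectrum ℝ P, 0 ≤ x := fun x hx =>
    spectrum_nonneg_of_nonneg (Matrix.nonneg_iff_posSemidef.2 hPsd) hx
  have hc : ∀ f : ℝ → ℝ, ContinuousOn f (spectrum ℝ P) := fun f =>
    Matrix.finite_real_spectrum.continuousOn f
  -- `0⁻¹ = 0` makes `Q` the pseudo-inverse of `√P`, and `E = √P Q` the projection onto its range.
  set Q : Matrix m m ℂ := cfc (fun x : ℝ => (√x)⁻¹) P with hQ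
  set E : Matrix m m ℂ := cfc (fun x : ℝ => √x * (√x)⁻¹) P
  have hQsa : Qᴴ = Q := (cfc_predicate (fun x : ℝ => (√x)⁻¹) P : IsSelfAdjoint Q)
  have hsqrtQ : cfc Real.sqrt P * Q = E := (cfc_mul _ _ P (hc _) (hc _)).symm
  have hPQ : P * Q = cfc Real.sqrt P := by
    rw [← cfc_id' ℝ P, hQ, ← cfc_mul _ _ P (hc _) (hc _), cfc_id' ℝ P]
    exact cfc_congr fun x _ => Real.div_sqrt
  have hEP : E * P = P := calc
    E * P = E * cfc (fun x : ℝ => x) P := by rw [cfc_id' ℝ P]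
    _ = cfc (fun x : ℝ => √x * (√x)⁻¹ * x) P := (cfc_mul _ _ P (hc _) (hc _)).symm
    _ = cfc (fun x : ℝ => x) P := cfc_congr fun x hx => by
      rcases (hspec x hx).eq_or_lt with rfl | h
      · simp only [mul_zero]
      · simp only [mul_inv_cancel₀ (Real.sqrt_pos.2 h).ne', one_mul]
    _ = P := cfc_id' ℝ P
  have hnorm : ‖Q * A‖ ≤ 1 := by
    have hVV : (Q * A) * (Q * A)ᴴ = Q * cfc Real.sqrt P := by
      rw [Matrix.conjTranspose_mul, hQsa, ← hPQ, hP]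
      simp only [Matrix.mul_assoc]
    have hE1 : ‖E‖ ≤ 1 := norm_cfc_le zero_le_one fun x _ => by
      rw [Real.norm_of_nonneg (by positivity)]
      exact mul_inv_le_one
    have hQE : Q * cfc Real.sqrt P = E := by
      rw [← hsqrtQ]; exact cfc_commute_cfc _ _ P
    rw [← sq_le_one_iff₀ (norm_nonneg _), sq, ← CStarRing.norm_self_mul_star]
    exact (congrArg norm (hVV.trans hQE)).trans_le hE1
  refine ⟨Q * A, hnorm, ?_, ?_⟩
  · rw [← mul_assoc, hsqrtQ, mul_eq_of_mul_mul_conjTranspose_eq hEP]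
  · rw [Matrix.conjTranspose_mul, hQsa, ← mul_assoc, hPQ]

theorem norm_star_dotProduct_mulVec_le (M : Matrix m m ℂ) (u v : m → ℂ) :
    ‖star v ⬝ᵥ M *ᵥ u‖ ≤ ‖M‖ * (‖WithLp.toLp 2 u‖ * ‖WithLp.toLp 2 v‖) := by
  have h := norm_inner_le_norm (𝕜 := ℂ) (WithLp.toLp 2 v) (WithLp.toLp 2 (M *ᵥ u))
  rw [EuclideanSpace.inner_toLp_toLp, dotProduct_comm] at h
  calc _ ≤ _ := h
    _ ≤ ‖WithLp.toLp 2 v‖ * (‖M‖ * ‖WithLp.toLp 2 u‖) := by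
      gcongr
      exact M.l2_opNorm_mulVec (WithLp.toLp 2 u)
    _ = _ := by ring

theorem norm_trace_mul_posSemidef_le (M : Matrix m m ℂ) {S : Matrix m m ℂ} (hS : S.PosSemidef) :
    ‖Matrix.trace (M * S)‖ ≤ ‖M‖ * (Matrix.trace S).re := by
  obtain ⟨B, rfl⟩ := CStarAlgebra.nonneg_iff_eq_star_mul_self.1 (Matrix.nonneg_iff_posSemidef.2 hS)
  have hM : Matrix.trace (M * (star B * B)) =
      ∑ k, star (star (B k)) ⬝ᵥ M *ᵥ star (B k) := by
    rw [← mul_assoc, Matrix.trace_mul_comm, ← mul_assoc, Matrix.mul_assoc]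
    simp only [star_star]
    rfl
  have hB : (Matrix.trace (star B * B)).re = ∑ k, ‖WithLp.toLp 2 (star (B k))‖ ^ 2 := by
    rw [Matrix.trace_mul_comm, Matrix.trace, Complex.re_sum]
    refine Finset.sum_congr rfl fun k _ => ?_
    simp [EuclideanSpace.norm_sq_eq, Matrix.mul_apply, Complex.mul_conj', ← Complex.ofReal_pow]
  rw [hM, hB, Finset.mul_sum]
  exact (norm_sum_le _ _).trans (Finset.sum_le_sum fun k _ =>
    (norm_star_dotProduct_mulVec_le M _ _).trans_eq (by rw [sq]))

theorem traceNorm_nonneg (A : Matrix m m ℂ) : 0 ≤ traceNorm A :=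
  (Complex.nonneg_iff.1 (Matrix.nonneg_iff_posSemidef.1
    (cfc_nonneg fun x _ => Real.sqrt_nonneg x)).trace_nonneg).1

theorem traceNorm_zero : traceNorm (0 : Matrix m m ℂ) = 0 := by
  simp [traceNorm]

theorem norm_trace_mul_le_traceNorm {W : Matrix m m ℂ} (hW : ‖W‖ ≤ 1) (A : Matrix m m ℂ) :
    ‖Matrix.trace (W * A)‖ ≤ traceNorm A := by
  obtain ⟨V, hV, hA, -⟩ := exists_polar_decomposition A
  calc ‖Matrix.trace (W * A)‖ = ‖Matrix.trace (V * W * cfc Real.sqrt (A * Aᴴ))‖ := by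
        conv_lhs => rw [hA, ← mul_assoc, Matrix.trace_mul_comm, ← mul_assoc]
    _ ≤ ‖V * W‖ * traceNorm A := norm_trace_mul_posSemidef_le _
      (Matrix.nonneg_iff_posSemidef.1 (cfc_nonneg fun x _ => Real.sqrt_nonneg x))
    _ ≤ traceNorm A := mul_le_of_le_one_left (traceNorm_nonneg A)
      ((norm_mul_le V W).trans (mul_le_one₀ hV (norm_nonneg W) hW))

theorem traceNorm_le_of_forall {A : Matrix m m ℂ} {a : ℝ}
    (h : ∀ W : Matrix m m ℂ, ‖W‖ ≤ 1 → ‖Matrix.trace (W * A)‖ ≤ a) : traceNorm A ≤ a := by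
  obtain ⟨V, hV, -, hA⟩ := exists_polar_decomposition A
  refine le_trans ?_ (h Vᴴ ((norm_star V).trans_le hV))
  rw [Matrix.trace_mul_comm, hA]
  exact Complex.re_le_norm _

theorem traceNorm_add_le (A B : Matrix m m ℂ) :
    traceNorm (A + B) ≤ traceNorm A + traceNorm B :=
  traceNorm_le_of_forall fun W hW => by
    rw [Matrix.mul_add, Matrix.trace_add]
    exact norm_add_le_of_le (norm_trace_mul_le_traceNorm hW A) (norm_trace_mul_le_traceNorm hW B)

theorem traceNorm_sub_le (A B : Matrix m m ℂ) :
    traceNorm (A - B) ≤ traceNorm A + traceNorm B :=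
  traceNorm_le_of_forall fun W hW => by
    rw [mul_sub, Matrix.trace_sub]
    exact norm_sub_le_of_le (norm_trace_mul_le_traceNorm hW A) (norm_trace_mul_le_traceNorm hW B)

theorem traceNorm_sum_le {ι : Type*} (s : Finset ι) (A : ι → Matrix m m ℂ) :
    traceNorm (∑ i ∈ s, A i) ≤ ∑ i ∈ s, traceNorm (A i) :=
  traceNorm_le_of_forall fun W hW => by
    rw [Matrix.mul_sum, Matrix.trace_sum]
    exact norm_sum_le_of_le s fun i _ => norm_trace_mul_le_traceNorm hW (A i)

theorem traceNorm_smul_le (c : ℂ) (A : Matrix m m ℂ) : traceNorm (c • A) ≤ ‖c‖ * traceNorm A :=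
  traceNorm_le_of_forall fun W hW => by
    rw [Matrix.mul_smul, Matrix.trace_smul, norm_smul]
    exact mul_le_mul_of_nonneg_left (norm_trace_mul_le_traceNorm hW A) (norm_nonneg c)

theorem traceNorm_expect_le {ι : Type*} [Fintype ι] [Nonempty ι] {A : ι → Matrix m m ℂ} {a : ℝ}
    (h : ∀ i, traceNorm (A i) ≤ a) : traceNorm (𝔼 i, A i) ≤ a :=
  traceNorm_le_of_forall fun W hW => by
    have hW' : Matrix.trace (W * 𝔼 i, A i) = 𝔼 i, Matrix.trace (W * A i) :=
      map_expect
      (((Matrix.traceLinearMap m ℂ ℂ).comp (LinearMap.mulLeft ℂ W)).restrictScalars ℚ≥0) A _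
    rw [hW']
    exact (RCLike.norm_expect_le (K := ℂ)).trans (Finset.expect_le Finset.univ_nonempty fun i _ =>
      (norm_trace_mul_le_traceNorm hW (A i)).trans (h i))

theorem traceNorm_vecMulVec_le (u v : m → ℂ) :
    traceNorm (Matrix.vecMulVec u (star v)) ≤ (∑ i, ‖u i‖ ^ 2 + ∑ i, ‖v i‖ ^ 2) / 2 :=
  traceNorm_le_of_forall fun W hW => by
    rw [Matrix.mul_vecMulVec, Matrix.trace_vecMulVec, dotProduct_comm]
    have h := norm_star_dotProduct_mulVec_le W u v
    have hu := EuclideanSpace.norm_sq_eq (WithLp.toLp 2 u)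
    have hv := EuclideanSpace.norm_sq_eq (WithLp.toLp 2 v)
    simp only at hu hv
    rw [← hu, ← hv]
    have := mul_le_of_le_one_left (by positivity) hW |>.trans' h
    linarith [two_mul_le_add_sq ‖WithLp.toLp 2 u‖ ‖WithLp.toLp 2 v‖]

theorem traceNorm_of_ite_eq_le {L : Type*} [DecidableEq L] (s : Finset m) (p q : m → L) :
    traceNorm (Matrix.of fun i j => if i ∈ s ∧ j ∈ s ∧ p i = q j then 1 else 0) ≤ s.card := by
  let u : (m → L) → L → m → ℂ := fun r l i => if i ∈ s ∧ r i = l then 1 else 0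
  have hu : ∀ r, ∑ l ∈ Finset.univ.image p, ∑ i, ‖u r l i‖ ^ 2 ≤ s.card := fun r => by
    rw [Finset.sum_comm]
    calc _ ≤ ∑ i, if i ∈ s then (1 : ℝ) else 0 := Finset.sum_le_sum fun i _ => by
          simp only [u, ite_and, apply_ite norm, norm_one, norm_zero, ite_pow, one_pow, ne_eq,
            two_ne_zero, not_false_eq_true, zero_pow, Finset.sum_ite_irrel,
            Finset.sum_const_zero, Finset.sum_ite_eq]
          split_ifs <;> norm_num
      _ = s.card := by simp
  have hdecomp : (Matrix.of fun i j => if i ∈ s ∧ j ∈ s ∧ p i = q j then (1 : ℂ) else 0) =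
      ∑ l ∈ Finset.univ.image p, Matrix.vecMulVec (u p l) (star (u q l)) := by
    ext i j
    rw [Matrix.sum_apply, Finset.sum_eq_single_of_mem (p i) (by simp)]
    · by_cases hi : i ∈ s <;> by_cases hj : j ∈ s <;>
        simp [Matrix.vecMulVec_apply, u, hi, hj, eq_comm, apply_ite]
    · intro l _ hl
      simp [Matrix.vecMulVec_apply, u, hl.symm]
  rw [hdecomp]
  calc _ ≤ ∑ l ∈ Finset.univ.image p, (∑ i, ‖u p l i‖ ^ 2 + ∑ i, ‖u q l i‖ ^ 2) / 2 :=
        (traceNorm_sum_le _ _).trans (Finset.sum_le_sum fun l _ => traceNorm_vecMulVec_le _ _)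
    _ ≤ s.card := by
      rw [← Finset.sum_div, Finset.sum_add_distrib]
      linarith [hu p, hu q]

end TraceNorm

section InjSum

theorem prod_update_apply {V X R : Type*} [Fintype V] [DecidableEq V] [CommMonoid R]
    (f : V → X → R) (w : V) (h : X → R) (z : V → X) :
    ∏ v, Function.update f w h v (z v) = h (z w) * ∏ v ∈ Finset.univ \ {w}, f v (z v) := by
  simp only [Function.apply_update (fun v (k : X → R) => k (z v)),
    Finset.prod_update_of_mem (Finset.mem_univ w)]

variable {V W X R : Type*} [Fintype V] [Fintype W] [Fintype X] [CommRing R]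

/-- The sum of `∏ v, f v (z v)` over the tuples `z` with pairwise distinct entries. -/
noncomputable def injSum (f : V → X → R) : R :=
  ∑ z : V ↪ X, ∏ v, f v (z v)

theorem injSum_comp_equiv (e : W ≃ V) (f : V → X → R) : injSum (fun w => f (e w)) = injSum f :=
  Fintype.sum_equiv (Equiv.embeddingCongr e (Equiv.refl X)) _ _ fun z =>
    Fintype.prod_equiv e _ _ fun w => by simp

theorem injSum_option (f : Option V → X → R) :
    injSum f = ∑ z : V ↪ X, (∏ v, f (some v) (z v)) * (∑ x, f none x - ∑ v, f none (z v)) := by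
  classical
  unfold injSum
  rw [Fintype.sum_equiv (Function.Embedding.optionEmbeddingEquiv V X) _
    (fun p : Σ z : V ↪ X, ↥(Set.range z)ᶜ => (∏ v, f (some v) (p.1 v)) * f none p.2)
    fun z => by rw [Fintype.prod_option, mul_comm]; rfl, Fintype.sum_sigma]
  refine Finset.sum_congr rfl fun z _ => ?_
  dsimp only
  rw [← Finset.mul_sum]
  refine congrArg _ ?_
  calc ∑ x : ↥(Set.range z)ᶜ, f none x = ∑ x ∈ (Finset.univ.map z)ᶜ, f none x :=
        (Finset.sum_subtype _ (fun x => by simp) _).symm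
    _ = ∑ x, f none x - ∑ v, f none (z v) := by
      rw [eq_sub_iff_add_eq, ← Finset.sum_map Finset.univ z (f none), Finset.sum_compl_add_sum]

theorem injSum_update_smul [DecidableEq V] (f : V → X → R) (w : V) (c : R) (h : X → R) :
    injSum (Function.update f w (c • h)) = c * injSum (Function.update f w h) := by
  simp only [injSum, Finset.mul_sum, prod_update_apply, Pi.smul_apply, smul_eq_mul, mul_assoc]

theorem injSum_option_of_sum_eq_zero [DecidableEq V] {f : Option V → X → R}
    (h : ∑ x, f none x = 0) :
    injSum f = -∑ w, injSum (Function.update (fun v => f (some v)) w (f none * f (some w))) := by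
  rw [injSum_option, h]
  simp only [injSum, zero_sub, mul_neg, Finset.sum_neg_distrib, Finset.mul_sum]
  rw [Finset.sum_comm]
  refine congrArg _ (Finset.sum_congr rfl fun w _ => Finset.sum_congr rfl fun z _ => ?_)
  rw [prod_update_apply, Fintype.prod_eq_mul_prod_compl w, Finset.compl_eq_univ_sdiff,
    Pi.mul_apply]
  ring

theorem norm_injSum_option_le [DecidableEq V] {f : Option V → X → ℂ} (h : ∑ x, f none x = 0)
    {ε B : ℝ} (hε : 0 < ε) (hB : ∀ w, ‖injSum
      (Function.update (fun v => f (some v)) w ((ε : ℂ)⁻¹ • (f none * f (some w))))‖ ≤ B) :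
    ‖injSum f‖ ≤ Fintype.card V * ε * B := by
  have hw : ∀ w, ‖injSum (Function.update (fun v => f (some v)) w (f none * f (some w)))‖ ≤
      ε * B := fun w => by
    rw [← smul_inv_smul₀ (Complex.ofReal_ne_zero.2 hε.ne') (f none * f (some w)),
      injSum_update_smul, norm_mul, Complex.norm_real, Real.norm_of_nonneg hε.le]
    exact mul_le_mul_of_nonneg_left (hB w) hε.le
  calc ‖injSum f‖ ≤ ∑ _w : V, ε * B := by
        rw [injSum_option_of_sum_eq_zero h, norm_neg]
        exact norm_sum_le_of_le _ fun w _ => hw w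
    _ = Fintype.card V * ε * B := by
      rw [Finset.sum_const, Finset.card_univ, nsmul_eq_mul, mul_assoc]

theorem injSum_le_one {p : V → X → ℝ} (h0 : ∀ v x, 0 ≤ p v x) (h1 : ∀ v, ∑ x, p v x ≤ 1) :
    injSum p ≤ 1 := by
  classical
  calc injSum p = ∑ z ∈ Finset.univ.map ⟨_, DFunLike.coe_injective (F := V ↪ X)⟩,
        ∏ v, p v (z v) := by rw [Finset.sum_map]; rfl
    _ ≤ ∑ z : V → X, ∏ v, p v (z v) :=
        Finset.sum_le_sum_of_subset_of_nonneg (Finset.subset_univ _)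
          fun z _ _ => Finset.prod_nonneg fun v _ => h0 _ _
    _ = ∏ v, ∑ x, p v x := (Fintype.prod_sum p).symm
    _ ≤ 1 := Finset.prod_le_one (fun v _ => Finset.sum_nonneg fun x _ => h0 _ _) fun v _ => h1 v

theorem norm_injSum_le_one {f : V → X → ℂ} (h1 : ∀ v, ∑ x, ‖f v x‖ ≤ 1) : ‖injSum f‖ ≤ 1 :=
  calc ‖injSum f‖ ≤ injSum fun v x => ‖f v x‖ :=
        (norm_sum_le _ _).trans_eq (by simp only [norm_prod, injSum])
    _ ≤ 1 := injSum_le_one (fun _ _ => norm_nonneg _) h1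

theorem one_sub_mul_injSum_le {p : Option V → X → ℝ} {ε : ℝ} (h0 : ∀ v x, 0 ≤ p v x)
    (h1 : ∑ x, p none x = 1) (hε : ∀ x, p none x ≤ ε) :
    (1 - Fintype.card V * ε) * injSum (fun v => p (some v)) ≤ injSum p := by
  rw [injSum_option, injSum, Finset.mul_sum]
  refine Finset.sum_le_sum fun z _ => ?_
  rw [mul_comm, h1]
  refine mul_le_mul_of_nonneg_left ?_ (Finset.prod_nonneg fun v _ => h0 _ _)
  have : ∑ v, p none (z v) ≤ ∑ _v : V, ε := Finset.sum_le_sum fun v _ => hε _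
  rw [Finset.sum_const, Finset.card_univ, nsmul_eq_mul] at this
  linarith

end InjSum

theorem sum_norm_inv_smul_mul_le {X : Type*} [Fintype X] {ε : ℝ} (hε : 0 < ε) {f : X → ℂ}
    (hf : ∀ x, ‖f x‖ ≤ ε) (g : X → ℂ) : ∑ x, ‖((ε : ℂ)⁻¹ • (f * g)) x‖ ≤ ∑ x, ‖g x‖ :=
  Finset.sum_le_sum fun x _ => by
    rw [Pi.smul_apply, norm_smul, norm_inv, Complex.norm_real, Real.norm_of_nonneg hε.le,
      Pi.mul_apply, norm_mul, ← mul_assoc]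
    exact mul_le_of_le_one_left (norm_nonneg _) ((inv_mul_le_one₀ hε).2 (hf x))

theorem card_le_card_erase_subtype_add_two {V : Type*} [DecidableEq V] (D : Finset V) {v : V}
    (w : {w // w ≠ v}) : D.card ≤ ((D.subtype (· ≠ v)).erase w).card + 2 := by
  have h₁ : D.card - 1 ≤ (D.subtype (· ≠ v)).card := by
    rw [Finset.card_subtype, Finset.filter_ne']
    exact Finset.pred_card_le_card_erase
  have h₂ : (D.subtype (· ≠ v)).card - 1 ≤ ((D.subtype (· ≠ v)).erase w).card :=
    Finset.pred_card_le_card_erase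
  lia

/- Resolving the position `v ∈ D` merges it with one of the other `|V| - 1` positions `w`, which
costs a factor `ε` and removes at most `v` and `w` from `D`. -/
theorem norm_injSum_le_pow {V X : Type*} [Fintype V] [Fintype X] {ε : ℝ} (hε : 0 < ε)
    (hVε : Fintype.card V * ε ≤ 1) {f : V → X → ℂ} {D : Finset V}
    (h1 : ∀ v, ∑ x, ‖f v x‖ ≤ 1) (h0 : ∀ v ∈ D, ∑ x, f v x = 0)
    (hfε : ∀ v ∈ D, ∀ x, ‖f v x‖ ≤ ε) :
    ‖injSum f‖ ≤ √(Fintype.card V * ε) ^ D.card := by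
  classical
  obtain rfl | ⟨v, hv⟩ := D.eq_empty_or_nonempty
  · simpa using norm_injSum_le_one h1
  have hlt : Fintype.card {w // w ≠ v} < Fintype.card V := Fintype.card_subtype_lt (not_not.2 rfl)
  have hle : (Fintype.card {w // w ≠ v} : ℝ) * ε ≤ Fintype.card V * ε := by gcongr
  set x := √(Fintype.card V * ε)
  have hx1 : x ≤ 1 := Real.sqrt_le_one.2 hVε
  have hx2 : Fintype.card V * ε = x ^ 2 := (Real.sq_sqrt (by positivity)).symm
  have hmerge : ∀ w : {w // w ≠ v}, ‖injSum (Function.update (fun u : {w // w ≠ v} => f u) w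
      ((ε : ℂ)⁻¹ • (f v * f w)))‖ ≤ x ^ (D.card - 2) := fun w => by
    set D' := (D.subtype (· ≠ v)).erase w
    have hmem : ∀ u ∈ D', u ≠ w ∧ ↑u ∈ D := fun u hu => by simpa [D'] using hu
    have ih := norm_injSum_le_pow hε (hle.trans hVε) (D := D')
      (f := Function.update (fun u : {w // w ≠ v} => f u) w ((ε : ℂ)⁻¹ • (f v * f w)))
      (fun u => ?_) (fun u hu => ?_) (fun u hu => ?_)
    · calc _ ≤ _ := ih
        _ ≤ x ^ D'.card := by gcongr; exact Real.sqrt_le_sqrt hle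
        _ ≤ x ^ (D.card - 2) := pow_le_pow_of_le_one (Real.sqrt_nonneg _) hx1
          (Nat.sub_le_of_le_add (card_le_card_erase_subtype_add_two D w))
    · obtain rfl | hu := eq_or_ne u w
      · rw [Function.update_self]
        exact (sum_norm_inv_smul_mul_le hε (hfε v hv) (f u)).trans (h1 u)
      · rw [Function.update_of_ne hu]
        exact h1 u
    · rw [Function.update_of_ne (hmem u hu).1]
      exact h0 u (hmem u hu).2
    · rw [Function.update_of_ne (hmem u hu).1]
      exact hfε u (hmem u hu).2
  rw [← injSum_comp_equiv (Equiv.optionSubtypeNe v)]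
  calc _ ≤ Fintype.card {w // w ≠ v} * ε * x ^ (D.card - 2) :=
        norm_injSum_option_le (by simpa using h0 v hv) hε (by simpa using hmerge)
    _ ≤ x ^ 2 * x ^ (D.card - 2) := by rw [← hx2]; gcongr
    _ ≤ x ^ D.card := by
      rw [← pow_add]
      exact pow_le_pow_of_le_one (Real.sqrt_nonneg _) hx1 (by lia)
termination_by Fintype.card V

theorem one_sub_le_injSum {V X : Type*} [Fintype V] [Fintype X]
    {ε : ℝ} {p : V → X → ℝ} (h0 : ∀ v x, 0 ≤ p v x) (h1 : ∀ v, ∑ x, p v x = 1)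
    (hε : ∀ v x, p v x ≤ ε) : 1 - (Fintype.card V : ℝ) ^ 2 * ε ≤ injSum p := by
  induction hk : Fintype.card V generalizing V with
  | zero =>
    have := Fintype.card_eq_zero_iff.1 hk
    simp [injSum]
  | succ k ih =>
    classical
    obtain ⟨v⟩ : Nonempty V := Fintype.card_pos_iff.1 (by lia)
    have hkv : Fintype.card {w // w ≠ v} = k := by simp [hk]
    obtain ⟨x, -, -⟩ := Finset.exists_ne_zero_of_sum_ne_zero ((h1 v).trans_ne one_ne_zero)
    have hε0 : 0 ≤ ε := (h0 v x).trans (hε v x)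
    have hle := injSum_le_one (p := fun w : {w // w ≠ v} => p w) (fun _ => h0 _) fun _ => (h1 _).le
    have hstep := one_sub_mul_injSum_le (p := fun w => p (Equiv.optionSubtypeNe v w))
      (fun _ => h0 _) (h1 _) (hε _)
    rw [injSum_comp_equiv, hkv] at hstep
    refine le_trans ?_ hstep
    have := ih (p := fun w : {w // w ≠ v} => p w) (fun _ => h0 _) (fun _ => h1 _)
      (fun _ => hε _) hkv
    simp only [Equiv.optionSubtypeNe_some]
    push_cast
    have hk : (0 : ℝ) ≤ k * ε := by positivity
    nlinarith [mul_le_mul_of_nonneg_left hle hk]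

section Twirl

theorem exists_perm_eq_comp_of_range_subset {V Y : Type*} [Finite V] {z z' : V → Y}
    (hz : Function.Injective z) (h : Set.range z ⊆ Set.range z') :
    ∃ τ : Equiv.Perm V, z' = z ∘ τ := by
  choose σ hσ using fun v => h ⟨v, rfl⟩
  have hσ_inj : Function.Injective σ := fun a b hab => hz (by rw [← hσ, ← hσ, hab])
  refine ⟨(Equiv.ofBijective σ (Finite.injective_iff_bijective.1 hσ_inj)).symm, ?_⟩
  rw [Equiv.eq_comp_symm]
  exact funext hσ

theorem expect_smul_eq_expect {G Y M : Type*} [Group G] [Fintype G] [Fintype Y] [MulAction G Y]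
    [MulAction.IsPretransitive G Y] [AddCommMonoid M] [Module ℚ≥0 M] (F : Y → M) (y : Y) :
    𝔼 g : G, F (g • y) = 𝔼 w, F w := by
  have : Nonempty Y := ⟨y⟩
  have hy : ∀ w : Y, 𝔼 g : G, F (g • w) = 𝔼 g : G, F (g • y) := fun w => by
    obtain ⟨h, rfl⟩ := MulAction.exists_smul_eq G y w
    exact Fintype.expect_equiv (Equiv.mulRight h) _ _ fun g => by simp [mul_smul]
  calc 𝔼 g : G, F (g • y) = 𝔼 w, 𝔼 g : G, F (g • w) := by
        simp only [hy, Fintype.expect_const]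
    _ = 𝔼 g : G, 𝔼 w, F (g • w) := Finset.expect_comm _ _ _
    _ = 𝔼 _g : G, 𝔼 w, F w := Finset.expect_congr rfl fun g _ =>
      Fintype.expect_equiv (MulAction.toPerm g) _ _ fun _ => rfl
    _ = 𝔼 w, F w := Fintype.expect_const _

instance {V X : Type*} [Finite V] : MulAction.IsPretransitive (Equiv.Perm X) (V ↪ X) :=
  ⟨Equiv.Perm.exists_smul_eq_embedding⟩

variable {V X : Type*} [Fintype V]

/-- The phase `∏ v, g (z v)` by which `U_g^{⊗ V}` multiplies the basis vector `|z⟩`. -/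
def signProd (g : X → ℤˣ) (z : V → X) : ℂ :=
  ∏ v, ((g (z v) : ℤ) : ℂ)

theorem star_signProd (g : X → ℤˣ) (z : V → X) : star (signProd g z) = signProd g z := by
  simp [signProd]

theorem signProd_mul_self (g : X → ℤˣ) (z : V → X) : signProd g z * signProd g z = 1 := by
  rw [signProd, ← Finset.prod_mul_distrib]
  exact Finset.prod_eq_one fun v _ => by rw [← Int.cast_mul, ← Units.val_mul]; simp

theorem norm_signProd (g : X → ℤˣ) (z : V → X) : ‖signProd g z‖ = 1 := by
  rw [← pow_eq_one_iff_of_nonneg (norm_nonneg _) two_ne_zero, sq, ← norm_mul, signProd_mul_self,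
    norm_one]

theorem signProd_comp_perm (g : X → ℤˣ) (z : V → X) (τ : Equiv.Perm V) :
    signProd g (z ∘ τ) = signProd g z :=
  Fintype.prod_equiv τ _ _ fun _ => rfl

variable [Fintype X] [DecidableEq X]

theorem expect_signProd_mul_signProd {z z' : V → X} (hz : Function.Injective z)
    (h : ¬∃ τ : Equiv.Perm V, z' = z ∘ τ) :
    𝔼 g : X → ℤˣ, signProd g z * signProd g z' = 0 := by
  obtain ⟨v₀, hv₀⟩ : ∃ v₀, z v₀ ∉ Set.range z' := by
    by_contra! hsub
    exact h (exists_perm_eq_comp_of_range_subset hz (Set.range_subset_iff.2 hsub))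
  -- Flipping the sign of `g` at `z v₀` negates the summand.
  let k : X → ℤˣ := Pi.mulSingle (z v₀) (-1)
  have hmul : ∀ g (w : V → X), signProd (g * k) w = signProd g w * signProd k w := fun g w => by
    simp [signProd, Finset.prod_mul_distrib]
  have hkz : signProd k z = -1 := by
    rw [signProd, Fintype.prod_eq_single v₀ fun v hv => by simp [k, hz.ne hv]]
    simp [k]
  have hkz' : signProd k z' = 1 := Finset.prod_eq_one fun v _ => by
    simp [k, show z' v ≠ z v₀ from fun hv => hv₀ ⟨v, hv⟩]
  have hflip : 𝔼 g : X → ℤˣ, signProd g z * signProd g z' =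
      𝔼 g : X → ℤˣ, -(signProd g z * signProd g z') :=
    Fintype.expect_equiv (Equiv.mulRight k) _ _ fun g => by
      simp [hmul, hkz, hkz']
  exact self_eq_neg.1 (hflip.trans (Finset.expect_neg_distrib _ _))

/-- The average of `|Ψ⟩⟨Ψ|` over `Ψ = (U_π U_g)^{⊗ V} Φ`, for uniform `g : X → {±1}` and uniform
permutations `π` of `X`. Since `π` and `π⁻¹` have the same law, `π` is written for `π⁻¹`. -/
noncomputable def twirl (Φ : (V → X) → ℂ) : Matrix (V → X) (V → X) ℂ :=
  𝔼 g : X → ℤˣ, 𝔼 π : Equiv.Perm X, Matrix.vecMulVec (fun z => signProd g (π ∘ z) * Φ (π ∘ z))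
    (star fun z => signProd g (π ∘ z) * Φ (π ∘ z))

theorem matrix_expect_apply {ι m n : Type*} [Fintype ι] (A : ι → Matrix m n ℂ) (i : m) (j : n) :
    (𝔼 k, A k) i j = 𝔼 k, A k i j := by
  rw [Finset.expect, Finset.expect, Matrix.smul_apply, Matrix.sum_apply]

theorem twirl_apply (Φ : (V → X) → ℂ) (z z' : V → X) :
    twirl Φ z z' = 𝔼 π : Equiv.Perm X,
      (𝔼 g : X → ℤˣ, signProd g (π ∘ z) * signProd g (π ∘ z')) *
        (Φ (π ∘ z) * star (Φ (π ∘ z'))) := by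
  simp only [Finset.expect_mul]
  rw [twirl, Finset.expect_comm]
  simp only [matrix_expect_apply]
  refine Finset.expect_congr rfl fun π _ => Finset.expect_congr rfl fun g _ => ?_
  rw [Matrix.vecMulVec_apply, Pi.star_apply, star_mul', star_signProd]
  ring

theorem star_twirl_apply (Φ : (V → X) → ℂ) (z z' : V → X) :
    star (twirl Φ z z') = twirl Φ z' z := by
  simp only [twirl_apply, ← starRingEnd_apply, map_expect (starRingEnd ℂ)]
  refine Finset.expect_congr rfl fun π _ => ?_
  simp only [map_mul, map_expect (starRingEnd ℂ), starRingEnd_apply, star_signProd, star_star]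
  simp only [mul_comm]

theorem twirl_apply_eq_zero (Φ : (V → X) → ℂ) {z z' : V → X} (hz : Function.Injective z)
    (h : ¬∃ τ : Equiv.Perm V, z' = z ∘ τ) : twirl Φ z z' = 0 := by
  rw [twirl_apply]
  refine Finset.expect_eq_zero fun π _ => ?_
  rw [expect_signProd_mul_signProd (π.injective.comp hz), zero_mul]
  rintro ⟨τ, hτ⟩
  exact h ⟨τ, π.injective.comp_left hτ⟩

theorem twirl_apply_comp_perm (Φ : (V → X) → ℂ) (z : V ↪ X) (τ : Equiv.Perm V) :
    twirl Φ z (z ∘ τ) = 𝔼 w : V ↪ X, Φ w * star (Φ (w ∘ τ)) := by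
  rw [twirl_apply, ← expect_smul_eq_expect (G := Equiv.Perm X) _ z]
  refine Finset.expect_congr rfl fun π _ => ?_
  simp only [← Function.comp_assoc, signProd_comp_perm, signProd_mul_self, Fintype.expect_const,
    one_mul]
  rfl

theorem twirl_indicator_apply (Φ : (V → X) → ℂ) (z z' : V → X) [Decidable (Function.Injective z)]
    [Decidable (Function.Injective z')] :
    twirl ({w | ¬Function.Injective w}.indicator Φ) z z' =
      if ¬Function.Injective z ∧ ¬Function.Injective z' then twirl Φ z z' else 0 := by
  classical
  simp only [twirl_apply, Set.indicator_apply, Set.mem_ofPred_eq, EquivLike.comp_injective]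
  split_ifs with h h' h' <;> simp_all

theorem traceNorm_twirl_le [DecidableEq V] (Φ : (V → X) → ℂ) :
    traceNorm (twirl Φ) ≤ ∑ z, ‖Φ z‖ ^ 2 := by
  refine traceNorm_expect_le fun g => traceNorm_expect_le fun π =>
    (traceNorm_vecMulVec_le _ _).trans_eq ?_
  rw [add_self_div_two]
  exact Fintype.sum_equiv (Equiv.arrowCongr (Equiv.refl V) π) _ _ fun z => by
    rw [norm_mul, norm_signProd, one_mul]; rfl

end Twirl

section Recoloring

theorem exists_recoloring_iff {V ι Y : Type*} [Finite V] {c f : V → ι} {z z' : V → Y}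
    (hz : Function.Injective z) (hz' : Function.Injective z') :
    (∃ τ : Equiv.Perm V, z' = z ∘ τ ∧ f ∘ τ = c) ↔
      Set.range (fun v => (z v, f v)) = Set.range fun v => (z' v, c v) := by
  have hinj : Function.Injective fun v => (z v, f v) := fun v w h => hz (congrArg Prod.fst h)
  constructor
  · rintro ⟨τ, rfl, rfl⟩
    exact (τ.surjective.range_comp fun v => (z v, f v)).symm
  · intro h
    obtain ⟨τ, hτ⟩ := exists_perm_eq_comp_of_range_subset hinj h.le
    exact ⟨τ, funext fun v => congrArg Prod.fst (congrFun hτ v),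
      funext fun v => (congrArg Prod.snd (congrFun hτ v)).symm⟩

variable {V X ι : Type*} [Fintype V]

/-- The coefficient of `⨂_v |α_{c(v)}⟩` at the basis tuple `z`. -/
def amplitude (α : ι → EuclideanSpace ℂ X) (c : V → ι) (z : V → X) : ℂ :=
  ∏ v, α (c v) (z v)

variable [Fintype X]

/-- The inner product of the restrictions of `⨂_v |α_{f(v)}⟩` and `⨂_v |α_{c(v)}⟩` to the tuples
with pairwise distinct entries. -/
noncomputable def overlap (α : ι → EuclideanSpace ℂ X) (c f : V → ι) : ℂ :=
  injSum fun v x => α (c v) x * star (α (f v) x)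

variable (X) in
open Classical in
/-- The average over the tuples `z` with pairwise distinct entries of `∑_τ |z⟩⟨z ∘ τ|`, where `τ`
runs over the permutations of `V` that pull the colouring `f` back to `c`. Since `z` is injective,
`z ∘ τ` determines `τ`, so each entry receives at most one summand. -/
noncomputable def recolorOp (c f : V → ι) : Matrix (V → X) (V → X) ℂ :=
  Matrix.of fun z z' =>
    if Function.Injective z ∧ ∃ τ : Equiv.Perm V, z' = z ∘ τ ∧ f ∘ τ = c then
      (Fintype.card (V ↪ X) : ℂ)⁻¹
    else 0

section Decomposition

theorem recolorOp_apply_comp_perm [DecidableEq ι] (c f : V → ι) {z : V → X}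
    (hz : Function.Injective z) (τ : Equiv.Perm V) :
    recolorOp X c f z (z ∘ τ) =
      if f = c ∘ τ.symm then (Fintype.card (V ↪ X) : ℂ)⁻¹ else 0 := by
  have h : (Function.Injective z ∧ ∃ σ : Equiv.Perm V, z ∘ τ = z ∘ σ ∧ f ∘ σ = c) ↔
      f = c ∘ τ.symm := by
    rw [and_iff_right hz, Equiv.eq_comp_symm]
    refine ⟨?_, fun hf => ⟨τ, rfl, hf⟩⟩
    rintro ⟨σ, hσ, rfl⟩
    rw [hz.comp_left hσ]
  simp only [recolorOp, Matrix.of_apply, h]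

theorem recolorOp_apply_eq_zero (c f : V → ι) {z z' : V → X}
    (h : Function.Injective z → ¬∃ τ : Equiv.Perm V, z' = z ∘ τ) : recolorOp X c f z z' = 0 :=
  if_neg fun ⟨hz, τ, hτ, _⟩ => h hz ⟨τ, hτ⟩

variable [DecidableEq X]

theorem twirl_amplitude_apply_comp_perm (α : ι → EuclideanSpace ℂ X) (c : V → ι) (z : V ↪ X)
    (τ : Equiv.Perm V) :
    twirl (amplitude α c) z (z ∘ τ) =
      overlap α c (c ∘ τ.symm) * (Fintype.card (V ↪ X) : ℂ)⁻¹ := by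
  rw [twirl_apply_comp_perm (amplitude α c) z τ, Fintype.expect_eq_sum_div_card,
    div_eq_mul_inv, overlap, injSum]
  refine congrArg (· * _) (Finset.sum_congr rfl fun w _ => ?_)
  rw [Finset.prod_mul_distrib, amplitude, amplitude, star_prod]
  exact congrArg _ (Fintype.prod_equiv τ _ _ fun v => by simp)

theorem twirl_amplitude_eq [Fintype ι] [DecidableEq V] (α : ι → EuclideanSpace ℂ X) (c : V → ι) :
    twirl (amplitude α c) = twirl ({w | ¬Function.Injective w}.indicator (amplitude α c)) +
      ∑ f : V → ι, overlap α c f • recolorOp X c f := by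
  classical
  ext z z'
  simp only [Matrix.add_apply, Matrix.sum_apply, Matrix.smul_apply, smul_eq_mul,
    twirl_indicator_apply]
  by_cases hz : Function.Injective z
  · rw [if_neg fun h => h.1 hz, zero_add]
    by_cases h : ∃ τ : Equiv.Perm V, z' = z ∘ τ
    · obtain ⟨τ, rfl⟩ := h
      simp only [recolorOp_apply_comp_perm c _ hz, mul_ite, mul_zero, Finset.sum_ite_eq',
        Finset.mem_univ, if_true]
      exact twirl_amplitude_apply_comp_perm α c ⟨z, hz⟩ τ
    · rw [twirl_apply_eq_zero _ hz h, Finset.sum_eq_zero]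
      exact fun f _ => by rw [recolorOp_apply_eq_zero c f fun _ => h, mul_zero]
  · have hsum : ∑ f : V → ι, overlap α c f * recolorOp X c f z z' = 0 :=
      Finset.sum_eq_zero fun f _ => by
        rw [recolorOp_apply_eq_zero c f fun hz' => (hz hz').elim, mul_zero]
    rw [hsum, add_zero]
    by_cases hz' : Function.Injective z'
    · rw [if_neg fun h => h.2 hz', ← star_twirl_apply, twirl_apply_eq_zero _ hz', star_zero]
      rintro ⟨τ, rfl⟩
      exact hz (hz'.comp τ.injective)
    · rw [if_pos ⟨hz, hz'⟩]

end Decomposition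

section RecolorOpBounds

theorem recolorOp_eq_zero {c f : V → ι} (h : ¬∃ τ : Equiv.Perm V, f ∘ τ = c) :
    recolorOp X c f = 0 := by
  ext z z'
  exact if_neg fun ⟨_, τ, _, hτ⟩ => h ⟨τ, hτ⟩

theorem two_le_hammingDist_of_comp_perm_eq [DecidableEq ι] {c f : V → ι} {τ : Equiv.Perm V}
    (h : f ∘ τ = c) (hne : f ≠ c) : 2 ≤ hammingDist f c := by
  by_contra! hlt
  have hone : hammingDist f c = 1 := by
    have := hammingDist_pos.2 hne
    lia
  obtain ⟨v, hv⟩ := Finset.card_eq_one.1 hone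
  have hdiff : ∀ u, f u ≠ c u ↔ u = v := by simpa [Finset.ext_iff] using hv
  -- Every position that `c` colours `f v` has the same colour under `f`, and so has `v` itself.
  have hlt : Finset.card {u | c u = f v} < Finset.card {u | f u = f v} := by
    refine Finset.card_lt_card (Finset.ssubset_iff_of_subset ?_ |>.2 ⟨v, by simp, ?_⟩)
    · intro u hu
      rw [Finset.mem_filter_univ] at hu ⊢
      have huv : u ≠ v := fun huv => (hdiff v).2 rfl (huv ▸ hu).symm
      exact (not_not.1 (mt (hdiff u).1 huv)).trans hu
    · rw [Finset.mem_filter_univ]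
      exact fun hv => (hdiff v).2 rfl hv.symm
  refine hlt.ne (Finset.card_equiv τ fun u => ?_)
  simp [← h]

variable [DecidableEq V] [DecidableEq X]

theorem traceNorm_recolorOp_le_one (c f : V → ι) : traceNorm (recolorOp X c f) ≤ 1 := by
  classical
  let S : Finset (V → X) := {z | Function.Injective z}
  have hS : S.card = Fintype.card (V ↪ X) :=
    (Fintype.card_subtype _).symm.trans
      (Fintype.card_congr (Equiv.subtypeInjectiveEquivEmbedding V X))
  have hK : recolorOp X c f = (Fintype.card (V ↪ X) : ℂ)⁻¹ •
      Matrix.of fun z z' : V → X => if z ∈ S ∧ z' ∈ S ∧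
        Set.range (fun v => (z v, f v)) = Set.range (fun v => (z' v, c v)) then 1 else 0 := by
    ext z z'
    have hiff : (Function.Injective z ∧ ∃ τ : Equiv.Perm V, z' = z ∘ τ ∧ f ∘ τ = c) ↔
        z ∈ S ∧ z' ∈ S ∧ Set.range (fun v => (z v, f v)) = Set.range (fun v => (z' v, c v)) := by
      rw [Finset.mem_filter_univ, Finset.mem_filter_univ]
      refine and_congr_right fun hz => ⟨?_, fun ⟨hz', h⟩ => (exists_recoloring_iff hz hz').2 h⟩
      rintro ⟨τ, rfl, hτ⟩
      have hz' := hz.comp τ.injective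
      exact ⟨hz', (exists_recoloring_iff hz hz').1 ⟨τ, rfl, hτ⟩⟩
    simp only [recolorOp, Matrix.of_apply, Matrix.smul_apply, smul_eq_mul, mul_ite, mul_one,
      mul_zero, hiff]
  calc traceNorm (recolorOp X c f) ≤ ‖(Fintype.card (V ↪ X) : ℂ)⁻¹‖ * S.card := by
        rw [hK]
        exact (traceNorm_smul_le _ _).trans
          (mul_le_mul_of_nonneg_left (traceNorm_of_ite_eq_le S _ _) (norm_nonneg _))
    _ ≤ 1 := by
      rw [hS, norm_inv, Complex.norm_natCast]
      exact inv_mul_le_one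

theorem sum_pow_hammingDist_le [Fintype ι] [DecidableEq ι] (c : V → ι) {r : ℝ} (hr : 0 ≤ r) :
    ∑ f : V → ι, r ^ hammingDist f c ≤ Real.exp (Fintype.card V * (Fintype.card ι * r)) := by
  have hcolor : ∀ v, ∑ i, (if i ≠ c v then r else 1) ≤ Real.exp (Fintype.card ι * r) := fun v =>
    calc ∑ i, (if i ≠ c v then r else 1) ≤ ∑ i, (r + if i = c v then 1 else 0) :=
          Finset.sum_le_sum fun i _ => by split_ifs <;> simp_all
      _ = Fintype.card ι * r + 1 := by simp [Finset.sum_add_distrib]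
      _ ≤ Real.exp (Fintype.card ι * r) := Real.add_one_le_exp _
  calc ∑ f : V → ι, r ^ hammingDist f c
      = ∑ f : V → ι, ∏ v, (if f v ≠ c v then r else 1) := by
        simp only [hammingDist, Finset.prod_ite, Finset.prod_const, one_pow, mul_one]
    _ = ∏ v, ∑ i, (if i ≠ c v then r else 1) :=
      (Fintype.prod_sum fun v i => if i ≠ c v then r else 1).symm
    _ ≤ ∏ _v : V, Real.exp (Fintype.card ι * r) := Finset.prod_le_prod
      (fun v _ => Finset.sum_nonneg fun i _ => by split_ifs <;> simp [hr]) fun v _ => hcolor v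
    _ = Real.exp (Fintype.card V * (Fintype.card ι * r)) := by
      rw [Finset.prod_const, Finset.card_univ, ← Real.exp_nat_mul]

end RecolorOpBounds

section Overlap

theorem sum_norm_sq_eq_one {α : ι → EuclideanSpace ℂ X} (hα : Orthonormal ℂ α) (i : ι) :
    ∑ x, ‖α i x‖ ^ 2 = 1 := by
  rw [← EuclideanSpace.norm_sq_eq, hα.norm_eq_one, one_pow]

theorem sum_norm_amplitude_sq [DecidableEq V] {α : ι → EuclideanSpace ℂ X} (hα : Orthonormal ℂ α)
    (c : V → ι) : ∑ z, ‖amplitude α c z‖ ^ 2 = 1 := by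
  simp only [amplitude, norm_prod, ← Finset.prod_pow]
  rw [← Fintype.prod_sum fun v x => ‖α (c v) x‖ ^ 2]
  exact Finset.prod_eq_one fun v _ => sum_norm_sq_eq_one hα _

theorem overlap_self (α : ι → EuclideanSpace ℂ X) (c : V → ι) :
    overlap α c c = (injSum fun v x => ‖α (c v) x‖ ^ 2 : ℝ) := by
  simp only [overlap, injSum, Complex.ofReal_sum, Complex.ofReal_prod, Complex.ofReal_pow,
    ← starRingEnd_apply, Complex.mul_conj']

theorem sum_norm_mul_star_le_one {α : ι → EuclideanSpace ℂ X} (hα : Orthonormal ℂ α) (i j : ι) :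
    ∑ x, ‖α i x * star (α j x)‖ ≤ 1 :=
  calc ∑ x, ‖α i x * star (α j x)‖ ≤ ∑ x, (‖α i x‖ ^ 2 + ‖α j x‖ ^ 2) / 2 :=
        Finset.sum_le_sum fun x _ => by
          rw [norm_mul, norm_star]
          linarith [two_mul_le_add_sq ‖α i x‖ ‖α j x‖]
    _ = 1 := by
      rw [← Finset.sum_div, Finset.sum_add_distrib, sum_norm_sq_eq_one hα,
        sum_norm_sq_eq_one hα, add_self_div_two]

theorem norm_overlap_le [DecidableEq ι] {α : ι → EuclideanSpace ℂ X} (hα : Orthonormal ℂ α) {ε : ℝ}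
    (hε : 0 < ε) (hflat : ∀ i x, ‖α i x‖ ^ 2 ≤ ε) (hVε : Fintype.card V * ε ≤ 1) (c f : V → ι) :
    ‖overlap α c f‖ ≤ √(Fintype.card V * ε) ^ hammingDist f c := by
  refine norm_injSum_le_pow hε hVε (fun v => sum_norm_mul_star_le_one hα _ _) (fun v hv => ?_)
    fun v _ x => ?_
  · have h := hα.inner_eq_zero (Finset.mem_filter_univ v |>.1 hv)
    simpa [PiLp.inner_apply] using h
  · rw [norm_mul, norm_star]
    nlinarith [two_mul_le_add_sq ‖α (c v) x‖ ‖α (f v) x‖, hflat (c v) x, hflat (f v) x]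

theorem one_le_card_mul_of_norm_sq_le {α : ι → EuclideanSpace ℂ X} (hα : Orthonormal ℂ α)
    {ε : ℝ} {i : ι} (hflat : ∀ x, ‖α i x‖ ^ 2 ≤ ε) : 1 ≤ Fintype.card X * ε := by
  rw [← sum_norm_sq_eq_one hα i, ← nsmul_eq_mul]
  exact Finset.sum_le_card_nsmul _ _ _ fun x _ => hflat x

theorem sum_norm_indicator_amplitude_sq [DecidableEq V] {α : ι → EuclideanSpace ℂ X}
    (hα : Orthonormal ℂ α) (c : V → ι) :
    ∑ z, ‖{w | ¬Function.Injective w}.indicator (amplitude α c) z‖ ^ 2 =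
      1 - injSum fun v x => ‖α (c v) x‖ ^ 2 := by
  classical
  have hinj : injSum (fun v x => ‖α (c v) x‖ ^ 2) =
      ∑ z : {z : V → X // Function.Injective z}, ‖amplitude α c z‖ ^ 2 :=
    Fintype.sum_equiv (Equiv.subtypeInjectiveEquivEmbedding V X).symm _ _ fun z => by
      simp only [amplitude, norm_prod, Finset.prod_pow]
      rfl
  have hind : ∑ z, ‖{w | ¬Function.Injective w}.indicator (amplitude α c) z‖ ^ 2 =
      ∑ z : {z : V → X // ¬Function.Injective z}, ‖amplitude α c z‖ ^ 2 := by
    rw [← Finset.sum_subtype {z | ¬Function.Injective z} (by simp)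
      fun z => ‖amplitude α c z‖ ^ 2, Finset.sum_filter]
    exact Finset.sum_congr rfl fun z _ => by
      by_cases h : Function.Injective z <;> simp [h]
  rw [hinj, hind, ← sum_norm_amplitude_sq hα c,
    ← Fintype.sum_subtype_add_sum_subtype Function.Injective fun z => ‖amplitude α c z‖ ^ 2,
    add_sub_cancel_left]

end Overlap

section Comparison

variable [DecidableEq V] [DecidableEq X]

theorem norm_overlap_mul_traceNorm_recolorOp_le [DecidableEq ι] {α : ι → EuclideanSpace ℂ X}
    {c f : V → ι} (hfc : f ≠ c) {q r : ℝ} (hq0 : 0 ≤ q) (hq1 : q ≤ 1) (hr : 0 ≤ r)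
    (h : ‖overlap α c f‖ ≤ (√q * r) ^ hammingDist f c) :
    ‖overlap α c f‖ * traceNorm (recolorOp X c f) ≤ q * r ^ hammingDist f c := by
  by_cases hτ : ∃ τ : Equiv.Perm V, f ∘ τ = c
  · obtain ⟨τ, hτ⟩ := hτ
    calc ‖overlap α c f‖ * traceNorm (recolorOp X c f) ≤ (√q * r) ^ hammingDist f c :=
          (mul_le_of_le_one_right (norm_nonneg _) (traceNorm_recolorOp_le_one c f)).trans h
      _ = √q ^ hammingDist f c * r ^ hammingDist f c := mul_pow _ _ _
      _ ≤ √q ^ 2 * r ^ hammingDist f c := by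
        gcongr ?_ * _
        exact pow_le_pow_of_le_one (Real.sqrt_nonneg q) (Real.sqrt_le_one.2 hq1)
          (two_le_hammingDist_of_comp_perm_eq hτ hfc)
      _ = q * r ^ hammingDist f c := by rw [Real.sq_sqrt hq0]
  · rw [recolorOp_eq_zero hτ, traceNorm_zero, mul_zero]
    positivity

theorem sum_norm_overlap_mul_traceNorm_recolorOp_le [Nonempty V] [Fintype ι] [DecidableEq ι]
    {α : ι → EuclideanSpace ℂ X} (hα : Orthonormal ℂ α) {ε : ℝ}
    (hflat : ∀ i x, ‖α i x‖ ^ 2 ≤ ε) (c : V → ι)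
    (hq : Fintype.card ι ^ 2 * Fintype.card V ^ 3 * ε ≤ 1) :
    ∑ f ∈ Finset.univ.erase c, ‖overlap α c f‖ * traceNorm (recolorOp X c f) ≤
      3 * (Fintype.card ι ^ 2 * Fintype.card V ^ 3 * ε) := by
  obtain ⟨v⟩ := ‹Nonempty V›
  have hn : (1 : ℝ) ≤ Fintype.card V := Nat.one_le_cast.2 (Fintype.card_pos_iff.2 ⟨v⟩)
  have hk : (1 : ℝ) ≤ Fintype.card ι := Nat.one_le_cast.2 (Fintype.card_pos_iff.2 ⟨c v⟩)
  have hε : 0 < ε :=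
    pos_of_mul_pos_right (one_pos.trans_le (one_le_card_mul_of_norm_sq_le hα (hflat (c v))))
      (Nat.cast_nonneg _)
  set n : ℝ := (Fintype.card V : ℝ)
  set k : ℝ := (Fintype.card ι : ℝ)
  set q := k ^ 2 * n ^ 3 * ε
  have hq0 : 0 ≤ q := by positivity
  have hnε : n * ε = q * ((k * n)⁻¹) ^ 2 := by
    simp only [q]
    field_simp
  have hnε1 : n * ε ≤ 1 := by
    rw [hnε]
    refine mul_le_one₀ hq (by positivity) (pow_le_one₀ (by positivity) ?_)
    exact inv_le_one_of_one_le₀ (one_le_mul_of_one_le_of_one_le hk hn)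
  have hoverlap : ∀ f, ‖overlap α c f‖ ≤ (√q * (k * n)⁻¹) ^ hammingDist f c := fun f => by
    refine (norm_overlap_le hα hε hflat hnε1 c f).trans_eq ?_
    rw [hnε, Real.sqrt_mul hq0, Real.sqrt_sq (by positivity)]
  calc ∑ f ∈ Finset.univ.erase c, ‖overlap α c f‖ * traceNorm (recolorOp X c f)
      ≤ ∑ f ∈ Finset.univ.erase c, q * ((k * n)⁻¹) ^ hammingDist f c :=
        Finset.sum_le_sum fun f hf => norm_overlap_mul_traceNorm_recolorOp_le
          (Finset.ne_of_mem_erase hf) hq0 hq (by positivity) (hoverlap f)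
    _ ≤ ∑ f : V → ι, q * ((k * n)⁻¹) ^ hammingDist f c :=
        Finset.sum_le_sum_of_subset_of_nonneg (Finset.erase_subset _ _) fun f _ _ => by positivity
    _ ≤ q * Real.exp 1 := by
      rw [← Finset.mul_sum]
      refine mul_le_mul_of_nonneg_left ((sum_pow_hammingDist_le c (by positivity)).trans_eq ?_) hq0
      congr 1
      change n * (k * (k * n)⁻¹) = 1
      field_simp
    _ ≤ 3 * q := by
      rw [mul_comm]
      exact mul_le_mul_of_nonneg_right Real.exp_one_lt_three.le hq0

theorem traceNorm_twirl_le_one {α : ι → EuclideanSpace ℂ X} (hα : Orthonormal ℂ α) (c : V → ι) :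
    traceNorm (twirl (amplitude α c)) ≤ 1 :=
  (traceNorm_twirl_le _).trans_eq (sum_norm_amplitude_sq hα c)

theorem traceNorm_twirl_sub_recolorOp_le [Fintype ι] [DecidableEq ι]
    {α : ι → EuclideanSpace ℂ X} (hα : Orthonormal ℂ α) {ε : ℝ}
    (hflat : ∀ i x, ‖α i x‖ ^ 2 ≤ ε) (c : V → ι) :
    traceNorm (twirl (amplitude α c) - recolorOp X c c) ≤ 2 * (Fintype.card V ^ 2 * ε) +
      ∑ f ∈ Finset.univ.erase c, ‖overlap α c f‖ * traceNorm (recolorOp X c f) := by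
  set p := injSum fun v x => ‖α (c v) x‖ ^ 2 with hp
  have hp1 : p ≤ 1 := injSum_le_one (fun _ _ => sq_nonneg _) fun v => (sum_norm_sq_eq_one hα _).le
  have hp2 : 1 - Fintype.card V ^ 2 * ε ≤ p := one_sub_le_injSum (fun _ _ => sq_nonneg _)
    (fun v => sum_norm_sq_eq_one hα _) fun v => hflat _
  have hdecomp : twirl (amplitude α c) - recolorOp X c c =
      twirl ({w | ¬Function.Injective w}.indicator (amplitude α c)) +
        (∑ f ∈ Finset.univ.erase c, overlap α c f • recolorOp X c f +
          ((p - 1 : ℝ) : ℂ) • recolorOp X c c) := by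
    rw [twirl_amplitude_eq, ← Finset.sum_erase_add _ _ (Finset.mem_univ c), overlap_self, ← hp,
      Complex.ofReal_sub, Complex.ofReal_one, sub_smul, one_smul]
    abel
  have hcollide : traceNorm (twirl ({w | ¬Function.Injective w}.indicator (amplitude α c))) ≤
      1 - p := (traceNorm_twirl_le _).trans_eq (sum_norm_indicator_amplitude_sq hα c)
  have hrecolor : traceNorm (∑ f ∈ Finset.univ.erase c, overlap α c f • recolorOp X c f) ≤
      ∑ f ∈ Finset.univ.erase c, ‖overlap α c f‖ * traceNorm (recolorOp X c f) :=
    (traceNorm_sum_le _ _).trans (Finset.sum_le_sum fun f _ => traceNorm_smul_le _ _)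
  have hself : traceNorm (((p - 1 : ℝ) : ℂ) • recolorOp X c c) ≤ 1 - p := by
    refine (traceNorm_smul_le _ _).trans ?_
    rw [Complex.norm_real, Real.norm_of_nonpos (sub_nonpos.2 hp1), neg_sub]
    exact mul_le_of_le_one_right (sub_nonneg.2 hp1) (traceNorm_recolorOp_le_one c c)
  rw [hdecomp]
  linarith [traceNorm_add_le
      (twirl ({w | ¬Function.Injective w}.indicator (amplitude α c)))
      (∑ f ∈ Finset.univ.erase c, overlap α c f • recolorOp X c f +
        ((p - 1 : ℝ) : ℂ) • recolorOp X c c),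
    traceNorm_add_le (∑ f ∈ Finset.univ.erase c, overlap α c f • recolorOp X c f)
      (((p - 1 : ℝ) : ℂ) • recolorOp X c c)]

theorem lemma4p5_general [Fintype ι] {α : ι → EuclideanSpace ℂ X} (hα : Orthonormal ℂ α) {ε : ℝ}
    (hflat : ∀ i x, ‖α i x‖ ^ 2 ≤ ε) (c : V → ι) :
    traceNorm (twirl (amplitude α c) - recolorOp X c c) ≤
      3 * (Fintype.card V ^ 2 * ε +
        Fintype.card X * Fintype.card ι ^ 2 * Fintype.card V ^ 4 * ε ^ 2) := by
  classical
  have hle := traceNorm_twirl_sub_recolorOp_le hα hflat c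
  obtain hV | ⟨⟨v⟩⟩ := isEmpty_or_nonempty V
  · have hc : Finset.univ.erase c = ∅ := by
      ext f
      simp [Subsingleton.elim f c]
    rw [hc] at hle
    simpa using hle
  have hXε := one_le_card_mul_of_norm_sq_le hα (hflat (c v))
  have hε : 0 < ε := pos_of_mul_pos_right (one_pos.trans_le hXε) (Nat.cast_nonneg _)
  have hn : (1 : ℝ) ≤ Fintype.card V := Nat.one_le_cast.2 (Fintype.card_pos_iff.2 ⟨v⟩)
  set n : ℝ := (Fintype.card V : ℝ)
  set k : ℝ := (Fintype.card ι : ℝ)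
  have hq : k ^ 2 * n ^ 3 * ε ≤ Fintype.card X * k ^ 2 * n ^ 4 * ε ^ 2 :=
    calc k ^ 2 * n ^ 3 * ε ≤ k ^ 2 * n ^ 3 * ε * (n * (Fintype.card X * ε)) :=
          le_mul_of_one_le_right (by positivity) (one_le_mul_of_one_le_of_one_le hn hXε)
      _ = Fintype.card X * k ^ 2 * n ^ 4 * ε ^ 2 := by ring
  have hnε : 0 ≤ n ^ 2 * ε := by positivity
  obtain hq1 | hq1 := le_total (k ^ 2 * n ^ 3 * ε) 1
  · have : Nonempty V := ⟨v⟩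
    linarith [sum_norm_overlap_mul_traceNorm_recolorOp_le hα hflat c hq1]
  · linarith [traceNorm_sub_le (twirl (amplitude α c)) (recolorOp X c c),
      traceNorm_twirl_le_one hα c, traceNorm_recolorOp_le_one (X := X) c c]

end Comparison

end Recoloring

section RegisterOps

variable {n s t : ℕ}

theorem tensorOp_conjTranspose (B : BlockIndex s t → Matrix (BitString n) (BitString n) ℂ) :
    tensorOp (fun v => (B v)ᴴ) = (tensorOp B)ᴴ := by
  ext z z'
  simp [tensorOp]

theorem inputState_eq_vecMulVec (α : Fin s → EuclideanSpace ℂ (BitString n)) :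
    inputState t α = Matrix.vecMulVec (amplitude α Prod.fst) (star (amplitude α Prod.fst)) := by
  ext z z'
  simp [inputState, tensorOp, ketBra, amplitude, Matrix.vecMulVec_apply, Finset.prod_mul_distrib]

theorem tensorOp_permOp_mul_phaseOp_mulVec (g : BitString n → ℤˣ) (π : Equiv.Perm (BitString n))
    (Φ : Tuple n s t → ℂ) :
    tensorOp (fun _ : BlockIndex s t => permOp π * phaseOp g) *ᵥ Φ =
      fun z => signProd g (π.symm ∘ z) * Φ (π.symm ∘ z) := by
  have hentry : ∀ y x, (permOp π * phaseOp g) y x =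
      if x = π.symm y then ((g x : ℤ) : ℂ) else 0 := fun y x => by
    simp [phaseOp, permOp, Equiv.eq_symm_apply, eq_comm]
  ext z
  rw [Matrix.mulVec, dotProduct, Fintype.sum_eq_single (π.symm ∘ z)]
  · simp [tensorOp, hentry, signProd]
  · intro z' hz'
    obtain ⟨v, hv⟩ := Function.ne_iff.1 hz'
    rw [tensorOp, Matrix.of_apply, Finset.prod_eq_zero (Finset.mem_univ v), zero_mul]
    exact (hentry _ _).trans (if_neg hv)

theorem outputState_eq_twirl (α : Fin s → EuclideanSpace ℂ (BitString n)) :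
    outputState t α = twirl (amplitude α Prod.fst) := by
  refine Finset.expect_congr rfl fun g _ =>
    Fintype.expect_equiv (Equiv.inv _) _ _ fun π => ?_
  rw [← Matrix.conjTranspose_mul, tensorOp_conjTranspose, inputState_eq_vecMulVec,
    Matrix.mul_vecMulVec, Matrix.vecMulVec_mul, ← Matrix.star_mulVec,
    tensorOp_permOp_mul_phaseOp_mulVec]
  rfl

theorem blockPerm_injective : Function.Injective (blockPerm (s := s) (t := t)) :=
  fun _ _ h => funext fun j => Equiv.ext fun i => congrArg Prod.snd (DFunLike.congr_fun h (j, i))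

theorem exists_blockPerm_eq_iff {τ : Equiv.Perm (BlockIndex s t)} :
    (∃ σ, blockPerm σ = τ) ↔ Prod.fst ∘ τ = Prod.fst := by
  constructor
  · rintro ⟨σ, rfl⟩
    rfl
  · intro h
    have hinj : ∀ j, Function.Injective fun i => (τ (j, i)).2 := fun j i i' hi => by
      have hfst := (congrFun h (j, i)).trans (congrFun h (j, i')).symm
      exact congrArg Prod.snd (τ.injective (Prod.ext hfst hi))
    exact ⟨fun j => Equiv.ofBijective _ (Finite.injective_iff_bijective.1 (hinj j)),
      Equiv.ext fun v => Prod.ext (congrFun h v).symm rfl⟩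

theorem uniState_eq_recolorOp :
    uniState n s t = recolorOp (BitString n) (Prod.fst : BlockIndex s t → Fin s) Prod.fst := by
  have hcard : (2 ^ n).descFactorial (s * t) = Fintype.card (BlockIndex s t ↪ BitString n) := by
    simp [Fintype.card_embedding_eq]
  ext z z'
  rw [uniState, hcard, recolorOp, Matrix.of_apply, Matrix.smul_apply, smul_eq_mul]
  simp only [Matrix.sum_apply, Matrix.single_apply]
  split_ifs with h
  · obtain ⟨hz, τ, rfl, hτ⟩ := h
    obtain ⟨σ, rfl⟩ := exists_blockPerm_eq_iff.2 hτ
    rw [Fintype.sum_eq_single ⟨z, hz⟩, Fintype.sum_eq_single σ, if_pos ⟨rfl, rfl⟩, mul_one]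
    · exact fun σ' hσ' => if_neg fun h => hσ' (blockPerm_injective
        (Equiv.coe_fn_injective (hz.comp_left h.2)))
    · exact fun w hw => Finset.sum_eq_zero fun σ' _ => if_neg fun h =>
        hw (DFunLike.coe_injective h.1)
  · have hne : ∀ (w : BlockIndex s t ↪ BitString n) (σ : Fin s → Equiv.Perm (Fin t)),
        ¬(⇑w = z ∧ (fun v => w (blockPerm σ v)) = z') := by
      rintro w σ ⟨rfl, rfl⟩
      exact h ⟨w.injective, blockPerm σ, rfl, exists_blockPerm_eq_iff.1 ⟨σ, rfl⟩⟩
    simp only [hne, if_false, Finset.sum_const_zero, mul_zero]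

end RegisterOps

theorem lemma4p5 :
    ∃ C : ℝ, 0 < C ∧
      ∀ (n s t : ℕ) (ε : ℝ) (α : Fin s → EuclideanSpace ℂ (BitString n)),
        Orthonormal ℂ α → (∀ j : Fin s, IsFlat ε (α j)) →
          traceNorm (outputState t α - uniState n s t) ≤
            C * (((s : ℝ) * (t : ℝ)) ^ 2 * ε +
              (2 : ℝ) ^ n * (s : ℝ) ^ 6 * (t : ℝ) ^ 4 * ε ^ 2) := by
  refine ⟨3, three_pos, fun n s t ε α hα hflat => ?_⟩
  rw [outputState_eq_twirl, uniState_eq_recolorOp]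
  refine (lemma4p5_general hα hflat Prod.fst).trans_eq ?_
  simp only [Fintype.card_prod, Fintype.card_fun, Fintype.card_fin, Fintype.card_bool]
  push_cast
  ring
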